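/- Let $G$ be a finite group, and write $\alpha^g=g^{-1}\alpha g$. A pair $(H,K)$ of subgroups of $G$ is called a Shoda pair of $G$ if $K\unlhd H$, $H/K$ is cyclic, and every $g\in G$ with $[H,g]\cap H\subseteq K$ lies in $H$, where $[H,g]=\{h^{-1}g^{-1}hg : h\in H\}$ is the set of commutators. Let $F$ be a number field, regarded as a subfield of $\mathbb{C}$ through a fixed embedding; characters are complex characters, and for a character $\psi$ we write $F(\psi)$ for the field generated over $F$ by the values of $\psi$. Let $(H,K)$ be a Shoda pair of $G$, let $\chi$ be a linear character of $H$ with kernel $K$, and let $C$ be the orbit of $\chi$ under the action of $\mathrm{Gal}(F(\chi)/F)$. Put $$\varepsilon_C(H,K)=\frac{1}{|H|}\sum_{h\in H}\mathrm{tr}_{F(\chi)/F}(\chi(h))\,h^{-1}\in FG,$$ which depends only on $C$; let $\mathrm{Cen}_G(\varepsilon_C(H,K))=\{g\in G:\varepsilon_C(H,K)^g=\varepsilon_C(H,K)\}$, and let $e_C(G,H,K)\in FG$ be the sum of the different $G$-conjugates $\varepsilon_C(H,K)^g$ ($g\in G$) of $\varepsilon_C(H,K)$. Let $\chi^G(g)=\frac{1}{|H|}\sum_{x\in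 G}\chi^{\circ}(xgx^{-1})$ be the induced character, where $\chi^\circ$ is $\chi$ on $H$ and $0$ off $H$. Then $\chi^G$ is an irreducible character of $G$, one has $H\le \mathrm{Cen}_G(\varepsilon_C(H,K))$ and $F(\chi^G)\subseteq F(\chi)$, and the primitive central idempotent $e_F(\chi^G)$ of $FG$ associated to $\chi^G$, that is, the unique primitive central idempotent $e$ of $FG$ with $\chi^G(e)\neq 0$ ($\chi^G$ extended linearly to $FG$), exists and equals $$e_F(\chi^G)=\frac{[\mathrm{Cen}_G(\varepsilon_C(H,K)):H]}{[F(\chi):F(\chi^G)]}\;e_C(G,H,K).$$ -/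

import Mathlib

noncomputable section

namespace Shoda

open MonoidAlgebra

/-! ### Shoda pairs -/

/-- `(H, K)` is a Shoda pair of `G`. Here `[H, g] ∩ H ⊆ K` refers to the set `[H, g]` of all
commutators `[h, g] = h⁻¹ g⁻¹ h g` with `h ∈ H`. -/
structure IsShodaPair {G : Type*} [Group G] (H K : Subgroup G) : Prop where
  le : K ≤ H
  [normal : (K.subgroupOf H).Normal]
  cyclic : IsCyclic (H ⧸ K.subgroupOf H)
  mem_of_commutators : ∀ g : G,
    (∀ h ∈ H, h⁻¹ * g⁻¹ * h * g ∈ H → h⁻¹ * g⁻¹ * h * g ∈ K) → g ∈ H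

/-! ### Characters and fields of character values -/

/-- The complex-valued function underlying a linear character. -/
def linFun {H : Type*} [Group H] (χ : H →* ℂˣ) : H → ℂ := fun h => (χ h : ℂ)

/-- `ψ : G → ℂ` is the character of an irreducible complex representation of `G`. -/
def IsIrreducibleCharacter {G : Type*} [Group G] (ψ : G → ℂ) : Prop :=
  ∃ (n : ℕ) (ρ : Representation ℂ G (Fin n → ℂ)), ρ.IsIrreducible ∧ ρ.character = ψ

open Classical in
/-- The induced character
`χ^G(g) = |H|⁻¹ ∑_{x ∈ G} χ°(x g x⁻¹)`, where `χ°` is `χ` on `H` and `0` off `H`. -/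
def inducedCharacter {G : Type*} [Group G] {H : Subgroup G} (χ : H → ℂ) : G → ℂ := fun g =>
  (Nat.card H : ℂ)⁻¹ *
    ∑ᶠ x : G, if hx : x * g * x⁻¹ ∈ H then χ ⟨x * g * x⁻¹, hx⟩ else 0

/-- The field `F(f)` generated over `F` by the values of `f`, inside `ℂ`. -/
def valueField (F : Type*) [Field F] [Algebra F ℂ] {α : Type*} (f : α → ℂ) :
    IntermediateField F ℂ :=
  IntermediateField.adjoin F (Set.range f)

/-- The value `f a`, as an element of the field `F(f)`. -/
def valueIn (F : Type*) [Field F] [Algebra F ℂ] {α : Type*} (f : α → ℂ) (a : α) :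
    valueField F f :=
  ⟨f a, IntermediateField.subset_adjoin F _ ⟨a, rfl⟩⟩

/-- `ψ` lies in the orbit of `χ` under `Gal(F(χ)/F)`: `ψ = σ ∘ χ` for some `σ`. -/
def GaloisConj (F : Type*) [Field F] [Algebra F ℂ] {H : Type*} [Group H] (χ ψ : H →* ℂˣ) :
    Prop :=
  ∃ σ : valueField F (linFun χ) ≃ₐ[F] valueField F (linFun χ),
    ∀ h : H, linFun ψ h = (σ (valueIn F (linFun χ) h) : ℂ)

section Galois

variable {F : Type*} [Field F] [Algebra F ℂ] {H : Type*} [Group H] {χ ψ θ : H →* ℂˣ}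

theorem GaloisConj.valueField_eq (hc : GaloisConj F χ ψ) :
    valueField F (linFun ψ) = valueField F (linFun χ) := by
  obtain ⟨σ, hσ⟩ := hc
  apply le_antisymm
  · refine IntermediateField.adjoin_le_iff.2 ?_
    rintro _ ⟨h, rfl⟩
    rw [hσ h]
    exact (σ _).2
  · let φ : valueField F (linFun χ) →ₐ[F] ℂ :=
      (valueField F (linFun χ)).val.comp (σ : valueField F (linFun χ) →ₐ[F] _)
    have key : ∀ x (hx : x ∈ valueField F (linFun χ)),
        φ ⟨x, hx⟩ ∈ valueField F (linFun ψ) := by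
      intro x hx
      have hle : valueField F (linFun χ) ≤
          ((valueField F (linFun ψ)).comap φ).map (valueField F (linFun χ)).val := by
        refine IntermediateField.adjoin_le_iff.2 ?_
        rintro _ ⟨h, rfl⟩
        refine ⟨valueIn F (linFun χ) h, ?_, rfl⟩
        have h1 : φ (valueIn F (linFun χ) h) = linFun ψ h := (hσ h).symm
        have h2 : φ (valueIn F (linFun χ) h) ∈ valueField F (linFun ψ) :=
          h1 ▸ (valueIn F (linFun ψ) h).2
        exact h2
      obtain ⟨y, hy, hyx⟩ := hle hx
      have hy' : y = ⟨x, hx⟩ := Subtype.ext hyx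
      exact hy' ▸ hy
    intro y hy
    have h1 := key _ (σ.symm ⟨y, hy⟩).2
    have h2 : φ (σ.symm ⟨y, hy⟩) = y := by simp [φ]
    exact h2 ▸ h1

theorem coe_equivOfEq {L M : IntermediateField F ℂ} (hLM : L = M) (x : L) :
    ((IntermediateField.equivOfEq hLM x : M) : ℂ) = x := by
  subst hLM; rfl

theorem coe_equivOfEq_symm {L M : IntermediateField F ℂ} (hLM : L = M) (x : M) :
    (((IntermediateField.equivOfEq hLM).symm x : L) : ℂ) = x := by
  subst hLM; rfl

theorem GaloisConj.refl (χ : H →* ℂˣ) : GaloisConj F χ χ := ⟨AlgEquiv.refl, fun _ => rfl⟩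

theorem GaloisConj.symm (hc : GaloisConj F χ ψ) : GaloisConj F ψ χ := by
  have he := hc.valueField_eq
  obtain ⟨σ, hσ⟩ := hc
  refine ⟨((IntermediateField.equivOfEq he).trans σ.symm).trans
    (IntermediateField.equivOfEq he).symm, fun h => ?_⟩
  have h1 : IntermediateField.equivOfEq he (valueIn F (linFun ψ) h) =
      σ (valueIn F (linFun χ) h) :=
    Subtype.ext ((coe_equivOfEq he _).trans (hσ h))
  rw [AlgEquiv.trans_apply, coe_equivOfEq_symm, AlgEquiv.trans_apply, h1,
    AlgEquiv.symm_apply_apply, valueIn]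

theorem GaloisConj.trans (h₁ : GaloisConj F χ ψ) (h₂ : GaloisConj F ψ θ) :
    GaloisConj F χ θ := by
  have he := h₁.valueField_eq
  obtain ⟨σ, hσ⟩ := h₁
  obtain ⟨τ, hτ⟩ := h₂
  refine ⟨σ.trans (((IntermediateField.equivOfEq he).symm.trans τ).trans
    (IntermediateField.equivOfEq he)), fun h => ?_⟩
  have h1 : (IntermediateField.equivOfEq he).symm (σ (valueIn F (linFun χ) h)) =
      valueIn F (linFun ψ) h :=
    Subtype.ext ((coe_equivOfEq_symm he _).trans (hσ h).symm)
  rw [AlgEquiv.trans_apply, AlgEquiv.trans_apply, coe_equivOfEq, AlgEquiv.trans_apply, h1, hτ h]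

theorem trace_congr {L M : IntermediateField F ℂ} (hLM : L = M) {x : ℂ} (hx : x ∈ L)
    (hx' : x ∈ M) : Algebra.trace F L ⟨x, hx⟩ = Algebra.trace F M ⟨x, hx'⟩ := by
  subst hLM; rfl

theorem GaloisConj.trace_eq (hc : GaloisConj F χ ψ) (h : H) :
    Algebra.trace F (valueField F (linFun χ)) (valueIn F (linFun χ) h) =
      Algebra.trace F (valueField F (linFun ψ)) (valueIn F (linFun ψ) h) := by
  have he := hc.valueField_eq
  obtain ⟨σ, hσ⟩ := hc
  rw [← Algebra.trace_eq_of_algEquiv σ]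
  have h1 : σ (valueIn F (linFun χ) h) = ⟨linFun ψ h, hσ h ▸ (σ _).2⟩ :=
    Subtype.ext (hσ h).symm
  rw [h1]
  exact trace_congr he.symm _ _

end Galois

/-! ### The sets `𝒞_F(H/K)` -/

/-- The linear characters of `H` with kernel `K`, that is, the faithful linear characters
of `H/K`, inflated to `H`. -/
def FaithfulChar {G : Type*} [Group G] (H K : Subgroup G) :=
  {χ : H →* ℂˣ // χ.ker.map H.subtype = K}

/-- Two characters are equivalent if they lie in the same Galois orbit over `F`. -/
def orbitSetoid (F : Type*) [Field F] [Algebra F ℂ] {G : Type*} [Group G] (H K : Subgroup G) :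
    Setoid (FaithfulChar H K) where
  r χ ψ := GaloisConj F χ.1 ψ.1
  iseqv := ⟨fun χ => GaloisConj.refl χ.1, GaloisConj.symm, GaloisConj.trans⟩

/-- `𝒞_F(H/K)`: the set of Galois orbits of linear characters of `H` with kernel `K`. -/
def Orbits (F : Type*) [Field F] [Algebra F ℂ] {G : Type*} [Group G] (H K : Subgroup G) :=
  Quotient (orbitSetoid F H K)

/-- The Galois orbit over `F` of a linear character `χ` of `H` with kernel `K`. -/
def orbit (F : Type*) [Field F] [Algebra F ℂ] {G : Type*} [Group G] {H K : Subgroup G}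
    (χ : H →* ℂˣ) (hχ : χ.ker.map H.subtype = K) : Orbits F H K :=
  Quotient.mk (orbitSetoid F H K) ⟨χ, hχ⟩

/-! ### Elements of the group algebra -/

/-- The element `|H|⁻¹ ∑_{h ∈ H} tr_{F(χ)/F}(χ(h)) h⁻¹` of `FH ⊆ FG`. -/
def epsilonChar (F : Type*) [Field F] [Algebra F ℂ] {G : Type*} [Group G] {H : Subgroup G}
    (χ : H →* ℂˣ) : MonoidAlgebra F G :=
  (Nat.card H : F)⁻¹ • ∑ᶠ h : H, single (h : G)⁻¹
    (Algebra.trace F (valueField F (linFun χ)) (valueIn F (linFun χ) h))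

/-- The element `ε_C(H, K)`, for `C ∈ 𝒞_F(H/K)`: it is
`|H|⁻¹ ∑_{h ∈ H} tr_{F(χ)/F}(χ(h)) h⁻¹` for any `χ ∈ C`. -/
def epsilon {F : Type*} [Field F] [Algebra F ℂ] {G : Type*} [Group G] {H K : Subgroup G}
    (C : Orbits F H K) : MonoidAlgebra F G :=
  Quotient.lift (s := orbitSetoid F H K) (fun χ => epsilonChar F χ.1) (by
    intro χ ψ hc
    have hc' : GaloisConj F χ.1 ψ.1 := hc
    simp only [epsilonChar, hc'.trace_eq]) C

/-- The conjugate `α^g = g⁻¹ α g`. -/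
def conjBy {F : Type*} [Field F] {G : Type*} [Group G] (α : MonoidAlgebra F G) (g : G) :
    MonoidAlgebra F G :=
  single g⁻¹ 1 * α * single g 1

theorem conjBy_one {F : Type*} [Field F] {G : Type*} [Group G] (α : MonoidAlgebra F G) :
    conjBy α 1 = α := by
  rw [conjBy, inv_one, ← one_def, one_mul, mul_one]

theorem conjBy_mul {F : Type*} [Field F] {G : Type*} [Group G] (α : MonoidAlgebra F G)
    (g h : G) : conjBy α (g * h) = conjBy (conjBy α g) h := by
  have h1 : (single (g * h) 1 : MonoidAlgebra F G) = single g 1 * single h 1 := by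
    rw [single_mul_single, one_mul]
  have h2 : (single (g * h)⁻¹ 1 : MonoidAlgebra F G) = single h⁻¹ 1 * single g⁻¹ 1 := by
    rw [single_mul_single, one_mul, mul_inv_rev]
  simp only [conjBy, h1, h2, mul_assoc]

/-- `Cen_G(α)`, the centralizer in `G` of an element `α` of the group algebra. -/
def Cen {F : Type*} [Field F] {G : Type*} [Group G] (α : MonoidAlgebra F G) : Subgroup G where
  carrier := {g | conjBy α g = α}
  one_mem' := conjBy_one α
  mul_mem' {g h} hg hh := by
    simp only [Set.mem_ofPred_eq] at *
    rw [conjBy_mul, hg, hh]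
  inv_mem' {g} hg := by
    simp only [Set.mem_ofPred_eq] at *
    rw [← hg, ← conjBy_mul, mul_inv_cancel, conjBy_one, hg]

/-- `e_C(G, H, K)`: the sum of the different `G`-conjugates of `ε_C(H, K)`. -/
def eC {F : Type*} [Field F] [Algebra F ℂ] {G : Type*} [Group G] [Finite G] {H K : Subgroup G}
    (C : Orbits F H K) : MonoidAlgebra F G :=
  ∑ x ∈ (Set.finite_range (conjBy (epsilon C))).toFinset, x

/-! ### Primitive central idempotents -/

/-- `e` is a primitive central idempotent of the ring `R`: a nonzero central idempotent that is
not the sum of two nonzero orthogonal central idempotents. -/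
structure IsPrimitiveCentralIdempotent {R : Type*} [Ring R] (e : R) : Prop where
  central : e ∈ Subring.center R
  idem : IsIdempotentElem e
  ne_zero : e ≠ 0
  primitive : ∀ a b : R, a ∈ Subring.center R → b ∈ Subring.center R →
    IsIdempotentElem a → IsIdempotentElem b → a * b = 0 → e = a + b → a = 0 ∨ b = 0

/-- The `F`-linear extension of `ψ : G → ℂ` to `FG`, evaluated at `α`. -/
def evalAt {F : Type*} [Field F] [Algebra F ℂ] {G : Type*} [Group G] (ψ : G → ℂ)
    (α : MonoidAlgebra F G) : ℂ :=
  ∑ᶠ g : G, algebraMap F ℂ (α.coeff g) * ψ g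

/-- `e = e_F(ψ)`: `e` is the unique primitive central idempotent of `FG` with `ψ(e) ≠ 0`. -/
def IsEF (F : Type*) [Field F] [Algebra F ℂ] {G : Type*} [Group G] (ψ : G → ℂ)
    (e : MonoidAlgebra F G) : Prop :=
  (IsPrimitiveCentralIdempotent e ∧ evalAt ψ e ≠ 0) ∧
    ∀ e' : MonoidAlgebra F G, IsPrimitiveCentralIdempotent e' → evalAt ψ e' ≠ 0 → e' = e

end Shoda

end

/-! Write ψ for the induced character and e_θ = |H|⁻¹ ∑ θ(h) h⁻¹ for a linear character θ of H. The
Shoda condition says that for g ∉ H some h ∈ H has g⁻¹hg ∈ H and χ(g⁻¹hg) ≠ χ(h) (`IsSeparated`).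
This forces e_χ g e_χ = 0 off H, so the corner e_χ ℂG e_χ is ℂ e_χ, and every central element acts
on e_χ by a scalar. The same holds for each Galois conjugate of χ. Hence the central elements |H|⁻¹
∑_g e_θ^g (`indIdem`), for θ conjugate to χ, are idempotents, and any two of them are equal or
orthogonal. Their coefficients are values of the induced characters.

Over F the candidate is E = |H|⁻¹ ∑_g tr_{F(ψ)/F}(ψ(g)) g⁻¹ (`fieldIdem`). Over ℂ it is the sum,
over embeddings τ of F(ψ), of distinct orthogonal idempotents of this kind, so it is a central
idempotent. A central element of FG killing e_χ kills all the conjugates of e_χ, and hence E; with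
the scalar action this gives primitivity (`isPrimitiveCentralIdempotent_fieldIdem`). A central α
acting on e_χ by c has ψ(α) = cψ(1), which gives uniqueness (`IsSeparated.isEF`).

The coefficient comes from computing |H|⁻¹ ∑_g ε^g twice: grouping equal conjugates gives [Cen : H]
e_C, and transitivity of the trace gives [F(χ):F(ψ)] E. Irreducibility of ψ is proved directly on
the induced representation. -/

noncomputable section

namespace Shoda

open MonoidAlgebra

/-! ### Idempotents of separated linear characters -/

section Idempotents

variable {k : Type*} [Field k] {G : Type*} [Group G] {H : Subgroup G}

/-- `θ` differs from each of its conjugates by elements outside `H` on the common domain. -/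
def IsSeparated (θ : H →* k) : Prop :=
  ∀ g : G, g ∉ H → ∃ (h : H) (hg : g⁻¹ * h * g ∈ H), θ ⟨g⁻¹ * h * g, hg⟩ ≠ θ h

/-- The idempotent `|H|⁻¹ ∑_{h ∈ H} θ(h) h⁻¹` of a linear character `θ` of `H`. -/
def charIdem [Fintype H] (θ : H →* k) : MonoidAlgebra k G :=
  (Nat.card H : k)⁻¹ • ∑ h : H, single (h : G)⁻¹ (θ h)

/-- The central element `|H|⁻¹ ∑_{g ∈ G} e^g`, where `e` is the idempotent of `θ`. -/
def indIdem [Fintype G] [Fintype H] (θ : H →* k) : MonoidAlgebra k G :=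
  (Nat.card H : k)⁻¹ • ∑ g : G, conjBy (charIdem θ) g

open Classical in
/-- The character of `G` induced from the linear character `θ` of `H`. -/
def indChar [Fintype G] (θ : H →* k) (g : G) : k :=
  (Nat.card H : k)⁻¹ * ∑ x : G, if hx : x * g * x⁻¹ ∈ H then θ ⟨x * g * x⁻¹, hx⟩ else 0

theorem single_mul_conjBy (α : MonoidAlgebra k G) (g : G) :
    single g 1 * conjBy α g = α * single g 1 := by
  simp only [conjBy, ← mul_assoc, single_mul_single, mul_inv_cancel, one_mul]
  rw [← one_def, one_mul]

theorem conjBy_mul_distrib (α β : MonoidAlgebra k G) (g : G) :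
    conjBy (α * β) g = conjBy α g * conjBy β g := by
  rw [conjBy, conjBy, mul_assoc _ _ (conjBy β g), single_mul_conjBy]
  simp only [mul_assoc]

theorem conjBy_smul (c : k) (α : MonoidAlgebra k G) (g : G) :
    conjBy (c • α) g = c • conjBy α g := by
  simp [conjBy]

theorem conjBy_sum {ι : Type*} (s : Finset ι) (f : ι → MonoidAlgebra k G) (g : G) :
    conjBy (∑ i ∈ s, f i) g = ∑ i ∈ s, conjBy (f i) g := by
  simp [conjBy, Finset.mul_sum, Finset.sum_mul]

theorem coeff_conjBy (α : MonoidAlgebra k G) (g x : G) :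
    (conjBy α g).coeff x = α.coeff (g * x * g⁻¹) := by
  simp [conjBy, mul_assoc]

theorem mem_center_of_conjBy {α : MonoidAlgebra k G} (h : ∀ g, conjBy α g = α) :
    α ∈ Subring.center (MonoidAlgebra k G) := by
  rw [Subring.mem_center_iff]
  intro β
  induction β using MonoidAlgebra.induction_linear with
  | zero => simp
  | add x y hx hy => rw [add_mul, mul_add, hx, hy]
  | single g r =>
    have h1 : (single g r : MonoidAlgebra k G) = r • single g 1 := by simp
    have h2 := single_mul_conjBy α g
    rw [h g] at h2
    rw [h1, smul_mul_assoc, h2, mul_smul_comm]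

theorem conjBy_of_mem_center {α : MonoidAlgebra k G}
    (h : α ∈ Subring.center (MonoidAlgebra k G)) (g : G) : conjBy α g = α := by
  rw [conjBy, Subring.mem_center_iff.1 h, mul_assoc, single_mul_single, inv_mul_cancel, one_mul,
    ← one_def, mul_one]

variable [Fintype H] (θ : H →* k)

theorem coeff_charIdem [DecidablePred (· ∈ H)] (x : G) :
    (charIdem θ).coeff x = (Nat.card H : k)⁻¹ * if hx : x⁻¹ ∈ H then θ ⟨x⁻¹, hx⟩ else 0 := by
  classical
  rw [charIdem, coeff_smul_apply, coeff_sum, Finsupp.finsetSum_apply, smul_eq_mul]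
  congr 1
  simp only [coeff_single, Finsupp.single_apply]
  split_ifs with hx
  · rw [Finset.sum_eq_single ⟨x⁻¹, hx⟩]
    · simp
    · intro b _ hb
      rw [if_neg]
      rintro rfl
      exact hb (by ext; simp)
    · simp
  · refine Finset.sum_eq_zero fun h _ => if_neg ?_
    rintro rfl
    exact hx (by simp)

theorem single_mul_charIdem (h : H) :
    single (h : G) 1 * charIdem θ = θ h • charIdem θ := by
  rw [charIdem, mul_smul_comm, smul_comm (θ h)]
  congr 1
  rw [Finset.mul_sum, Finset.smul_sum]
  refine Fintype.sum_equiv (Equiv.mulRight h⁻¹) _ _ fun h' => ?_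
  simp [mul_comm (θ h), ← map_mul]

theorem charIdem_mul_single (h : H) :
    charIdem θ * single (h : G) 1 = θ h • charIdem θ := by
  rw [charIdem, smul_mul_assoc, smul_comm (θ h)]
  congr 1
  rw [Finset.sum_mul, Finset.smul_sum]
  refine Fintype.sum_equiv (Equiv.mulLeft h⁻¹) _ _ fun h' => ?_
  simp [← mul_assoc, ← map_mul]

theorem conjBy_charIdem (h : H) : conjBy (charIdem θ) h = charIdem θ := by
  have h1 := single_mul_charIdem θ h⁻¹
  rw [Subgroup.coe_inv] at h1
  rw [conjBy, h1, smul_mul_assoc, charIdem_mul_single, smul_smul, ← map_mul]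
  simp

variable {θ}

/-- Inserting h before g and absorbing it on the left gives the factor θ(h); moving it past g and
absorbing it on the right gives θ(g⁻¹hg). Separation makes these differ. -/
theorem IsSeparated.charIdem_mul_single_mul (hθ : IsSeparated θ) {g : G} (hg : g ∉ H) :
    charIdem θ * single g 1 * charIdem θ = 0 := by
  obtain ⟨h, hh, hne⟩ := hθ g hg
  have h1 : charIdem θ * single (h : G) 1 * single g 1 * charIdem θ =
      charIdem θ * single g 1 * (single (g⁻¹ * h * g) 1 * charIdem θ) := by
    simp only [mul_assoc]
    simp only [← mul_assoc (single _ _) (single _ _), single_mul_single]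
    simp
  rw [charIdem_mul_single, single_mul_charIdem θ ⟨_, hh⟩, smul_mul_assoc, smul_mul_assoc,
    mul_smul_comm, ← sub_eq_zero, ← sub_smul, smul_eq_zero] at h1
  exact h1.resolve_left (sub_ne_zero.2 hne.symm)

section

variable [Fintype G]

variable (θ) in
theorem indIdem_mem_center : indIdem θ ∈ Subring.center (MonoidAlgebra k G) := by
  refine mem_center_of_conjBy fun g => ?_
  rw [indIdem, conjBy_smul, conjBy_sum]
  congr 1
  simp only [← conjBy_mul]
  exact Equiv.sum_comp (Equiv.mulRight g) (conjBy (charIdem θ))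

-- This is the bridge between idempotents and characters, used both for evaluating ψ and for Galois
-- descent.
variable (θ) in
theorem coeff_indIdem (x : G) :
    (indIdem θ).coeff x = (Nat.card H : k)⁻¹ * indChar θ x⁻¹ := by
  classical
  rw [indIdem, coeff_smul_apply, coeff_sum, Finsupp.finsetSum_apply, smul_eq_mul, indChar,
    Finset.mul_sum, Finset.mul_sum, Finset.mul_sum]
  refine Finset.sum_congr rfl fun g _ => ?_
  rw [coeff_conjBy, coeff_charIdem]
  simp only [mul_inv_rev, inv_inv, mul_assoc]

/-- Central elements are fixed by conjugation, so their action on one idempotent carries over to all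
its conjugates. -/
theorem mul_indIdem {z : MonoidAlgebra k G} {c : k}
    (hz : z ∈ Subring.center (MonoidAlgebra k G)) (h : z * charIdem θ = c • charIdem θ) :
    z * indIdem θ = c • indIdem θ := by
  rw [indIdem, mul_smul_comm, smul_comm c]
  congr 1
  rw [Finset.mul_sum, Finset.smul_sum]
  refine Finset.sum_congr rfl fun g _ => ?_
  rw [← conjBy_smul, ← h, conjBy_mul_distrib, conjBy_of_mem_center hz]

end

variable (θ) [CharZero k]

omit θ in
theorem card_subgroup_ne_zero : (Nat.card H : k) ≠ 0 := by
  simp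

theorem charIdem_mul_self : charIdem θ * charIdem θ = charIdem θ := by
  nth_rewrite 1 [charIdem]
  rw [smul_mul_assoc, Finset.sum_mul]
  have : ∀ h : H, single (h : G)⁻¹ (θ h) * charIdem θ = charIdem θ := by
    intro h
    have h1 : (single (h : G)⁻¹ (θ h) : MonoidAlgebra k G) = θ h • single ((h⁻¹ : H) : G) 1 := by
      simp
    rw [h1, smul_mul_assoc, single_mul_charIdem, smul_smul, ← map_mul]
    simp
  rw [Finset.sum_congr rfl fun h _ => this h, Finset.sum_const, Finset.card_univ,
    ← Nat.card_eq_fintype_card, ← Nat.cast_smul_eq_nsmul k, smul_smul,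
    inv_mul_cancel₀ card_subgroup_ne_zero, one_smul]

theorem charIdem_ne_zero : charIdem θ ≠ 0 := by
  classical
  intro h
  have h1 := coeff_charIdem θ 1
  rw [h] at h1
  have h2 : θ ⟨1⁻¹, by simp⟩ = 1 := by
    rw [← map_one θ]; congr 1; ext; simp
  rw [dif_pos (by simp), h2] at h1
  simp at h1
  exact Nat.cast_ne_zero.2 Fintype.card_ne_zero h1.symm

variable {θ}

theorem IsSeparated.exists_smul (hθ : IsSeparated θ) (α : MonoidAlgebra k G) :
    ∃ c : k, charIdem θ * α * charIdem θ = c • charIdem θ := by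
  induction α using MonoidAlgebra.induction_linear with
  | zero => exact ⟨0, by simp⟩
  | add x y hx hy =>
    obtain ⟨c, hc⟩ := hx
    obtain ⟨d, hd⟩ := hy
    exact ⟨c + d, by rw [mul_add, add_mul, hc, hd, add_smul]⟩
  | single g r =>
    have h1 : (single g r : MonoidAlgebra k G) = r • single g 1 := by simp
    rw [h1, mul_smul_comm, smul_mul_assoc]
    by_cases hg : g ∈ H
    · exact ⟨r * θ ⟨g, hg⟩, by
        rw [charIdem_mul_single θ ⟨g, hg⟩, smul_mul_assoc, charIdem_mul_self, smul_smul]⟩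
    · exact ⟨0, by rw [hθ.charIdem_mul_single_mul hg, smul_zero, zero_smul]⟩

theorem IsSeparated.exists_smul_of_mem_center (hθ : IsSeparated θ) {z : MonoidAlgebra k G}
    (hz : z ∈ Subring.center (MonoidAlgebra k G)) :
    ∃ c : k, z * charIdem θ = c • charIdem θ := by
  obtain ⟨c, hc⟩ := hθ.exists_smul z
  exact ⟨c, by rw [← hc, Subring.mem_center_iff.1 hz, mul_assoc, charIdem_mul_self]⟩

variable [Fintype G]

/-- Since e^g e = g⁻¹(e g e), only the |H| terms with g ∈ H survive, each equal to e. -/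
theorem IsSeparated.indIdem_mul_charIdem (hθ : IsSeparated θ) :
    indIdem θ * charIdem θ = charIdem θ := by
  classical
  rw [indIdem, smul_mul_assoc, Finset.sum_mul]
  have key : ∀ g : G, conjBy (charIdem θ) g * charIdem θ =
      if g ∈ H then charIdem θ else 0 := by
    intro g
    split_ifs with hg
    · rw [conjBy_charIdem θ ⟨g, hg⟩, charIdem_mul_self]
    · rw [conjBy, mul_assoc, mul_assoc, ← mul_assoc (charIdem θ),
        hθ.charIdem_mul_single_mul hg, mul_zero]
  rw [Finset.sum_congr rfl fun g _ => key g, ← Finset.sum_filter, Finset.sum_const,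
    ← Nat.cast_smul_eq_nsmul k, smul_smul]
  have : (Finset.univ.filter (· ∈ H)).card = Nat.card H := by
    rw [Nat.card_eq_fintype_card, Fintype.card_subtype]
  rw [this, inv_mul_cancel₀ card_subgroup_ne_zero, one_smul]

theorem IsSeparated.indIdem_mul_self (hθ : IsSeparated θ) :
    indIdem θ * indIdem θ = indIdem θ := by
  have := mul_indIdem (c := 1) (indIdem_mem_center θ)
    (by rw [hθ.indIdem_mul_charIdem, one_smul])
  rwa [one_smul] at this

/-- The scalar by which z acts on the idempotent of θ is itself idempotent in the field. -/
theorem IsSeparated.mul_indIdem_eq (hθ : IsSeparated θ) {z : MonoidAlgebra k G}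
    (hz : z ∈ Subring.center (MonoidAlgebra k G)) (hi : z * z = z) :
    z * indIdem θ = 0 ∨ z * indIdem θ = indIdem θ := by
  obtain ⟨c, hc⟩ := hθ.exists_smul_of_mem_center hz
  have h1 : c * c = c := by
    have h2 : z * (z * charIdem θ) = c • charIdem θ := by rw [← mul_assoc, hi, hc]
    rw [hc, mul_smul_comm, hc, smul_smul] at h2
    exact smul_left_injective k (charIdem_ne_zero θ) h2
  rw [mul_indIdem hz hc]
  rcases (IsIdempotentElem.iff_eq_zero_or_one (p := c)).1 h1 with rfl | rfl
  · simp
  · simp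

theorem IsSeparated.indIdem_mul_indIdem {η : H →* k} (hθ : IsSeparated θ) (hη : IsSeparated η)
    (hne : indIdem θ ≠ indIdem η) : indIdem θ * indIdem η = 0 := by
  rcases hη.mul_indIdem_eq (indIdem_mem_center θ) hθ.indIdem_mul_self with h | h
  · exact h
  rcases hθ.mul_indIdem_eq (indIdem_mem_center η) hη.indIdem_mul_self with h' | h'
  · rw [Subring.mem_center_iff.1 (indIdem_mem_center η), h']
  · exact absurd (by rw [← h', ← Subring.mem_center_iff.1 (indIdem_mem_center η), h]) hne

end Idempotents

/-! ### The induced representation: irreducibility and character -/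

section InducedRepresentation

variable {k : Type*} [Field k] {G : Type*} [Group G] {H : Subgroup G} (θ : H →* k)

/-- The right regular representation on functions `G → k`. -/
def rightRegular (k G : Type*) [Field k] [Group G] : Representation k G (G → k) where
  toFun g := LinearMap.funLeft k k (· * g)
  map_one' := by ext; simp [LinearMap.funLeft]
  map_mul' a b := by
    refine LinearMap.ext fun f => funext fun x => ?_
    simp [LinearMap.funLeft_apply, mul_assoc]

theorem rightRegular_apply (g : G) (f : G → k) (x : G) : rightRegular k G g f x = f (x * g) := rfl

/-- The functions `f : G → k` with `f (h x) = θ(h) f(x)` for all `h ∈ H`. -/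
def inducedSpace : Submodule k (G → k) where
  carrier := {f | ∀ (h : H) (x : G), f (h * x) = θ h * f x}
  zero_mem' := by intro h x; simp
  add_mem' := by intro a b ha hb h x; simp [ha h x, hb h x, mul_add]
  smul_mem' := by intro c a ha h x; simp [ha h x, mul_left_comm]

theorem inducedSpace_le_comap (g : G) :
    inducedSpace θ ≤ (inducedSpace θ).comap (rightRegular k G g) := by
  intro f hf h x
  simp only [rightRegular_apply, mul_assoc]
  exact hf h (x * g)

/-- The representation induced from the linear character `θ`. -/
def inducedRep : Representation k G (inducedSpace θ) :=
  (rightRegular k G).subrepresentation (inducedSpace θ) (inducedSpace_le_comap θ)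

theorem coe_inducedRep_apply (g : G) (f : inducedSpace θ) (x : G) :
    (inducedRep θ g f : G → k) x = (f : G → k) (x * g) := rfl

open Classical in
/-- The extension of `θ` by zero, as an element of the induced space. -/
def inducedDelta : inducedSpace θ where
  val x := if hx : x ∈ H then θ ⟨x, hx⟩ else 0
  property := by
    intro h x
    by_cases hx : x ∈ H
    · have hx' : (h : G) * x ∈ H := mul_mem h.2 hx
      simp only [hx, hx', dif_pos]
      rw [← map_mul]; rfl
    · have hx' : (h : G) * x ∉ H := fun h' => hx ((Subgroup.mul_mem_cancel_left H h.2).1 h')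
      simp [hx, hx']

theorem inducedDelta_coe (h : H) : (inducedDelta θ : G → k) h = θ h := by
  simp [inducedDelta]

theorem inducedDelta_of_notMem {x : G} (hx : x ∉ H) : (inducedDelta θ : G → k) x = 0 := by
  simp [inducedDelta, hx]

variable [Fintype G] [Fintype H] [CharZero k]

-- The translate of the delta function by x⁻¹ is supported on the coset Hx, so each point is reached
-- by |H| values of x. Thus the translates span the induced space.
omit [CharZero k] in
theorem sum_smul_inducedDelta (f : inducedSpace θ) :
    ∑ x : G, (f : G → k) x • inducedRep θ x⁻¹ (inducedDelta θ) = (Nat.card H : k) • f := by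
  classical
  ext y
  simp only [Submodule.coe_sum, Finset.sum_apply, Submodule.coe_smul, Pi.smul_apply, smul_eq_mul,
    coe_inducedRep_apply]
  rw [← Equiv.sum_comp ((Equiv.inv G).trans (Equiv.mulRight y))]
  have key : ∀ x : G, (f : G → k) (x⁻¹ * y) * (inducedDelta θ : G → k) (y * (x⁻¹ * y)⁻¹) =
      if x ∈ H then (f : G → k) y else 0 := by
    intro x
    rw [show y * (x⁻¹ * y)⁻¹ = x by group]
    split_ifs with hx
    · have h1 := f.2 ⟨x, hx⟩ (x⁻¹ * y)
      have h2 := inducedDelta_coe θ ⟨x, hx⟩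
      simp only [mul_inv_cancel_left] at h1 h2
      rw [h1, h2, mul_comm]
    · rw [inducedDelta_of_notMem θ hx, mul_zero]
  refine (Finset.sum_congr rfl fun x _ => key x).trans ?_
  rw [← Finset.sum_filter, Finset.sum_const, ← Nat.cast_smul_eq_nsmul k,
    Nat.card_eq_fintype_card, Fintype.card_subtype, smul_eq_mul]

-- The average transforms by θ under H on both sides. Separation makes such a function vanish off H,
-- and on H it is determined by its value at 1.
omit [Fintype G] [CharZero k] in
theorem sum_smul_inducedRep (hθ : IsSeparated θ) (f : inducedSpace θ) :
    ∑ h : H, θ h⁻¹ • inducedRep θ (h : G) f =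
      ((Nat.card H : k) * (f : G → k) 1) • inducedDelta θ := by
  set F := ∑ h : H, θ h⁻¹ • inducedRep θ (h : G) f with hF
  have hFx : ∀ x, (F : G → k) x = ∑ h : H, θ h⁻¹ * (f : G → k) (x * h) := by
    intro x
    simp [hF, coe_inducedRep_apply]
  have hr : ∀ x (h : H), (F : G → k) (x * h) = θ h * (F : G → k) x := by
    intro x h
    rw [hFx, hFx, Finset.mul_sum]
    refine Fintype.sum_equiv (Equiv.mulLeft h) _ _ fun h' => ?_
    have e : θ h'⁻¹ = θ h * θ (h * h')⁻¹ := by rw [mul_comm, ← map_mul]; congr 1; group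
    rw [e, Equiv.coe_mulLeft, Subgroup.coe_mul, mul_assoc, mul_assoc]
  ext x
  rw [Submodule.coe_smul, Pi.smul_apply, smul_eq_mul]
  by_cases hx : x ∈ H
  · have h1 : (F : G → k) x = θ ⟨x, hx⟩ * (F : G → k) 1 := by simpa using F.2 ⟨x, hx⟩ 1
    have h2 : (F : G → k) 1 = Nat.card H * (f : G → k) 1 := by
      rw [hFx]
      have : ∀ h : H, θ h⁻¹ * (f : G → k) (1 * h) = (f : G → k) 1 := by
        intro h
        have := f.2 h 1
        rw [mul_one] at this
        rw [one_mul, this, ← mul_assoc, ← map_mul]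
        simp
      rw [Finset.sum_congr rfl fun h _ => this h, Finset.sum_const, Finset.card_univ,
        ← Nat.card_eq_fintype_card, nsmul_eq_mul]
    rw [h1, h2, inducedDelta_coe θ ⟨x, hx⟩, mul_comm]
  · rw [inducedDelta_of_notMem θ hx, mul_zero]
    -- Evaluate at xh = (xhx⁻¹)x using right and left equivariance; the two factors differ by
    -- separation.
    obtain ⟨h, hh, hne⟩ := hθ x⁻¹ (by simpa using hx)
    have h1 := hr x h
    have h2 := F.2 ⟨_, hh⟩ x
    rw [show x⁻¹⁻¹ * (h : G) * x⁻¹ * x = x * h by group] at h2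
    rw [h1, ← sub_eq_zero, ← sub_mul, mul_eq_zero] at h2
    exact h2.resolve_left (sub_ne_zero.2 hne.symm)

/-- A nonzero vector can be translated to be nonzero at 1; averaging then produces the delta
function, whose translates span. -/
theorem isIrreducible_inducedRep (hθ : IsSeparated θ) : (inducedRep θ).IsIrreducible := by
  have hd : inducedDelta θ ≠ 0 := by
    intro h
    have := inducedDelta_coe θ 1
    rw [h] at this
    simp at this
  have : Nontrivial (Subrepresentation (inducedRep θ)) := by
    refine ⟨⊥, ⊤, fun h => hd ?_⟩
    have h1 : inducedDelta θ ∈ (⊤ : Subrepresentation (inducedRep θ)) := Submodule.mem_top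
    rw [← h] at h1
    exact h1
  refine { eq_bot_or_eq_top := fun W => ?_ }
  by_cases hW : ∃ f ∈ W, f ≠ 0
  · right
    obtain ⟨f, hfW, hf⟩ := hW
    obtain ⟨x, hx⟩ : ∃ x, (f : G → k) x ≠ 0 := by
      by_contra! h
      exact hf (Subtype.ext (funext h))
    have h1 : inducedRep θ x f ∈ W := W.apply_mem_toSubmodule x hfW
    have h2 := sum_smul_inducedRep θ hθ (inducedRep θ x f)
    rw [coe_inducedRep_apply, one_mul] at h2
    have h3 : ((Nat.card H : k) * (f : G → k) x) • inducedDelta θ ∈ W.toSubmodule := by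
      rw [← h2]
      exact Submodule.sum_mem _ fun h _ =>
        Submodule.smul_mem _ _ (W.apply_mem_toSubmodule _ h1)
    have h4 : inducedDelta θ ∈ W.toSubmodule :=
      (Submodule.smul_mem_iff _ (mul_ne_zero card_subgroup_ne_zero hx)).1 h3
    rw [eq_top_iff]
    intro v _
    have h5 : (Nat.card H : k) • v ∈ W.toSubmodule := by
      rw [← sum_smul_inducedDelta]
      exact Submodule.sum_mem _ fun h _ =>
        Submodule.smul_mem _ _ (W.apply_mem_toSubmodule _ h4)
    exact (Submodule.smul_mem_iff _ card_subgroup_ne_zero).1 h5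
  · left
    push Not at hW
    rw [eq_bot_iff]
    intro v hv
    rw [hW v hv]
    exact Submodule.zero_mem _

/-- The projection of `G → k` onto the induced space. -/
def inducedProj : (G → k) →ₗ[k] (G → k) :=
  (Nat.card H : k)⁻¹ • ∑ h : H, θ h⁻¹ • LinearMap.funLeft k k ((h : G) * ·)

omit [Fintype G] [CharZero k] in
theorem inducedProj_apply (f : G → k) (x : G) :
    inducedProj θ f x = (Nat.card H : k)⁻¹ * ∑ h : H, θ h⁻¹ * f (h * x) := by
  simp [inducedProj, LinearMap.funLeft_apply]

omit [Fintype G] [CharZero k] in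
theorem inducedProj_mem (f : G → k) : inducedProj θ f ∈ inducedSpace θ := by
  intro h x
  rw [inducedProj_apply, inducedProj_apply, mul_left_comm]
  congr 1
  rw [Finset.mul_sum]
  refine Fintype.sum_equiv (Equiv.mulRight h) _ _ fun h' => ?_
  have e : θ h'⁻¹ = θ h * θ (h' * h)⁻¹ := by rw [← map_mul]; congr 1; group
  rw [e, Equiv.coe_mulRight, Subgroup.coe_mul, mul_assoc, mul_assoc]

omit [Fintype G] in
theorem inducedProj_of_mem {f : G → k} (hf : f ∈ inducedSpace θ) : inducedProj θ f = f := by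
  ext x
  rw [inducedProj_apply]
  have : ∀ h : H, θ h⁻¹ * f (h * x) = f x := by
    intro h
    rw [hf h x, ← mul_assoc, ← map_mul]
    simp
  rw [Finset.sum_congr rfl fun h _ => this h, Finset.sum_const, Finset.card_univ,
    ← Nat.card_eq_fintype_card, ← Nat.cast_smul_eq_nsmul k, smul_eq_mul,
    inv_mul_cancel_left₀ card_subgroup_ne_zero]

/-- Translation composed with the projection maps all of G → k into the induced space, so its trace
is that of the restriction and can be read off the standard basis. -/
theorem character_inducedRep (g : G) : (inducedRep θ).character g = indChar θ g := by
  classical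
  have hmem : ∀ f, (rightRegular k G g * inducedProj θ) f ∈ inducedSpace θ := fun f =>
    inducedSpace_le_comap θ g (inducedProj_mem θ f)
  have h1 : inducedRep θ g =
      (rightRegular k G g * inducedProj θ).restrict fun f _ => hmem f := by
    refine LinearMap.ext fun f => Subtype.ext ?_
    change rightRegular k G g f = rightRegular k G g (inducedProj θ f)
    rw [inducedProj_of_mem θ f.2]
  rw [Representation.character, h1, LinearMap.trace_restrict_eq_of_forall_mem _ _ hmem,
    LinearMap.trace_eq_matrix_trace k (Pi.basisFun k G), Matrix.trace, indChar, Finset.mul_sum]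
  refine Finset.sum_congr rfl fun x _ => ?_
  rw [Matrix.diag_apply, LinearMap.toMatrix_apply, Pi.basisFun_repr, Pi.basisFun_apply,
    Module.End.mul_apply, rightRegular_apply, inducedProj_apply]
  congr 1
  simp only [Pi.single_apply]
  have hinv : ∀ h : H, (h : G) * (x * g) = x → (h : G) = (x * g * x⁻¹)⁻¹ := fun h h' => by
    rw [eq_inv_iff_mul_eq_one, ← mul_assoc, h', mul_inv_cancel]
  split_ifs with hx
  · rw [Finset.sum_eq_single (⟨x * g * x⁻¹, hx⟩⁻¹)]
    · rw [if_pos (by simp [mul_assoc]), inv_inv, mul_one]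
    · intro h _ hh
      rw [if_neg, mul_zero]
      intro h'
      exact hh (Subtype.ext (hinv h h'))
    · simp
  · refine Finset.sum_eq_zero fun h _ => ?_
    rw [if_neg, mul_zero]
    intro h'
    refine hx ?_
    rw [← inv_inv (x * g * x⁻¹), ← hinv h h']
    exact H.inv_mem h.2

end InducedRepresentation

/-! ### Transfer to coordinate space -/

section

variable {G : Type*} [Group G]

/-- An irreducible finite-dimensional representation has irreducible character. -/
theorem isIrreducibleCharacter_of_isIrreducible {V : Type*} [AddCommGroup V] [Module ℂ V]
    [FiniteDimensional ℂ V] (ρ : Representation ℂ G V) (h : ρ.IsIrreducible) :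
    IsIrreducibleCharacter ρ.character := by
  let e : V ≃ₗ[ℂ] (Fin (Module.finrank ℂ V) → ℂ) := (Module.finBasis ℂ V).equivFun
  let σ : Representation ℂ G (Fin (Module.finrank ℂ V) → ℂ) :=
    { toFun := fun g => e.conj (ρ g)
      map_one' := by simp [Module.End.one_eq_id]
      map_mul' := fun a b => by rw [map_mul, Module.End.mul_eq_comp, LinearEquiv.conj_comp,
        Module.End.mul_eq_comp] }
  have hσ : ∀ g v, σ g (e v) = e (ρ g v) := fun g v => by
    simp [σ, LinearEquiv.conj_apply]
  refine ⟨_, σ, ?_, ?_⟩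
  · let o : Subrepresentation ρ ≃o Subrepresentation σ :=
      { toFun := fun W => ⟨W.toSubmodule.map e.toLinearMap, by
          rintro g _ ⟨v, hv, rfl⟩
          exact ⟨ρ g v, W.apply_mem_toSubmodule g hv, (hσ g v).symm⟩⟩
        invFun := fun W => ⟨W.toSubmodule.comap e.toLinearMap, by
          intro g v hv
          have := W.apply_mem_toSubmodule g hv
          change e (ρ g v) ∈ W.toSubmodule
          rw [← hσ]
          exact this⟩
        left_inv := fun W => by
          ext v; simp
        right_inv := fun W => by
          ext v; simp
        map_rel_iff' := Submodule.map_le_map_iff_of_injective e.injective _ _ }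
    exact o.isSimpleOrder_iff.1 h
  · ext g
    exact LinearMap.trace_conj' (ρ g) e

end

/-! ### Change of coefficient field -/

section BaseChange

variable {k k' : Type*} [Field k] [Field k'] {G : Type*} [Group G] {H : Subgroup G}

theorem mapRingHom_conjBy (f : k →+* k') (α : MonoidAlgebra k G) (g : G) :
    mapRingHom G f (conjBy α g) = conjBy (mapRingHom G f α) g := by
  simp [conjBy]

theorem mapRingHom_smul (f : k →+* k') (c : k) (α : MonoidAlgebra k G) :
    mapRingHom G f (c • α) = f c • mapRingHom G f α := by
  ext x; simp

theorem mapRingHom_mem_center (f : k →+* k') {α : MonoidAlgebra k G}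
    (h : α ∈ Subring.center (MonoidAlgebra k G)) :
    mapRingHom G f α ∈ Subring.center (MonoidAlgebra k' G) :=
  mem_center_of_conjBy fun g => by rw [← mapRingHom_conjBy, conjBy_of_mem_center h]

theorem mapRingHom_injective (f : k →+* k') : Function.Injective (mapRingHom G f) :=
  map_injective (f : k →+ k') f.injective

theorem mapRingHom_charIdem [Fintype H] (f : k →+* k') (θ : H →* k) :
    mapRingHom G f (charIdem θ) = charIdem ((f : k →* k').comp θ) := by
  simp [charIdem, mapRingHom_smul]

theorem map_indChar [Fintype G] (f : k →+* k') (θ : H →* k) (g : G) :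
    f (indChar θ g) = indChar ((f : k →* k').comp θ) g := by
  simp [indChar, apply_dite f]

theorem IsSeparated.map {θ : H →* k} (hθ : IsSeparated θ) (f : k →+* k') :
    IsSeparated ((f : k →* k').comp θ) := fun g hg =>
  let ⟨h, hh, hne⟩ := hθ g hg
  ⟨h, hh, fun e => hne (f.injective e)⟩

end BaseChange

/-! ### Primitive central idempotents of a ring -/

section PrimitiveCentralIdempotents

variable {R : Type*} [Ring R]

/-- Primitivity applies to the orthogonal splitting e = ef + (e - ef). -/
theorem IsPrimitiveCentralIdempotent.mul_eq_zero_or {e f : R}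
    (he : IsPrimitiveCentralIdempotent e) (hf : f ∈ Subring.center R) (hi : IsIdempotentElem f) :
    e * f = 0 ∨ e * f = e := by
  have hc := Subring.mem_center_iff.1 hf
  have hi' : f * f = f := hi
  have he' : e * e = e := he.idem
  have h0 : e * f * (e * f) = e * f := by
    rw [mul_assoc, ← mul_assoc f, ← hc e, mul_assoc e f f, hi', ← mul_assoc, he']
  have h1 : e * f * e = e * f := by rw [mul_assoc, ← hc, ← mul_assoc, he']
  have h2 : e * (e * f) = e * f := by rw [← mul_assoc, he']
  have h := he.primitive (e * f) (e - e * f) (mul_mem he.central hf)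
    (sub_mem he.central (mul_mem he.central hf)) h0
    (by rw [IsIdempotentElem, sub_mul, mul_sub, mul_sub, he', h0, h1, h2]; simp)
    (by rw [mul_sub, h1, h0, sub_self]) (by simp)
  exact h.imp id fun h => (sub_eq_zero.1 h).symm

theorem IsPrimitiveCentralIdempotent.eq_of_mul_ne_zero {e f : R}
    (he : IsPrimitiveCentralIdempotent e) (hf : IsPrimitiveCentralIdempotent f)
    (hne : e * f ≠ 0) : e = f := by
  have h1 := (he.mul_eq_zero_or hf.central hf.idem).resolve_left hne
  have hc := Subring.mem_center_iff.1 hf.central e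
  rw [hc] at hne h1
  rw [← h1, (hf.mul_eq_zero_or he.central he.idem).resolve_left hne]

end PrimitiveCentralIdempotents

/-! ### Evaluating the induced character on central elements -/

section Evaluation

variable {F : Type*} [Field F] [Algebra F ℂ] {G : Type*} [Group G] [Fintype G] {H : Subgroup G}
  [Fintype H] (θ : H →* ℂ)

theorem evalAt_indChar (α : MonoidAlgebra F G) :
    evalAt (indChar θ) α = (Nat.card H : ℂ) *
      (mapRingHom G (algebraMap F ℂ) α * indIdem θ).coeff 1 := by
  rw [evalAt, finsum_eq_sum_of_fintype, coeff_mul_apply_left, Finsupp.sum_fintype _ _ (by simp),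
    Finset.mul_sum]
  refine Finset.sum_congr rfl fun g _ => ?_
  rw [coeff_indIdem, coeff_mapRingHom, mul_one, inv_inv, mul_left_comm,
    mul_inv_cancel_left₀ card_subgroup_ne_zero]

theorem indChar_one : indChar θ 1 = (Nat.card H : ℂ)⁻¹ * Nat.card G := by
  have : ∀ h : (1 : G) ∈ H, θ ⟨1, h⟩ = 1 := fun h => map_one θ
  simp [indChar, this]

/-- The value is c times the degree [G : H] of the induced character. -/
theorem evalAt_indChar_ne_zero_iff {α : MonoidAlgebra F G} {c : ℂ}
    (hα : α ∈ Subring.center (MonoidAlgebra F G))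
    (hc : mapRingHom G (algebraMap F ℂ) α * charIdem θ = c • charIdem θ) :
    evalAt (indChar θ) α ≠ 0 ↔ c ≠ 0 := by
  rw [evalAt_indChar, mul_indIdem (mapRingHom_mem_center _ hα) hc, coeff_smul_apply,
    coeff_indIdem, inv_one, indChar_one]
  simp

/-- A competitor e' acts on the idempotent of θ by a nonzero scalar while e acts by 1, so e'e ≠ 0;
primitive central idempotents with nonzero product coincide. -/
theorem IsSeparated.isEF {θ : H →* ℂ} (hθ : IsSeparated θ) {e : MonoidAlgebra F G}
    (he : IsPrimitiveCentralIdempotent e)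
    (h : mapRingHom G (algebraMap F ℂ) e * charIdem θ = charIdem θ) :
    IsEF F (indChar θ) e := by
  refine ⟨⟨he, (evalAt_indChar_ne_zero_iff θ he.central (c := 1) (by rw [h, one_smul])).2
    one_ne_zero⟩, fun e' he' hne => ?_⟩
  obtain ⟨c, hc⟩ := hθ.exists_smul_of_mem_center
    (mapRingHom_mem_center (algebraMap F ℂ) he'.central)
  rw [evalAt_indChar_ne_zero_iff θ he'.central hc] at hne
  refine he'.eq_of_mul_ne_zero he fun h0 => ?_
  have h1 : mapRingHom G (algebraMap F ℂ) (e' * e) * charIdem θ = c • charIdem θ := by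
    rw [map_mul, mul_assoc, h, hc]
  rw [h0, map_zero, zero_mul] at h1
  exact smul_ne_zero hne (charIdem_ne_zero θ) h1.symm

end Evaluation

/-! ### Traces and embeddings of fields of values -/

section Fields

variable {F : Type*} [Field F] [Algebra F ℂ]

/-- If `M ≤ L`, then `L`, regarded as an extension of `M`, is `F`-isomorphic to `L`. -/
def extendScalarsEquiv {M L : IntermediateField F ℂ} (h : M ≤ L) :
    L ≃ₐ[F] IntermediateField.extendScalars h :=
  AlgEquiv.ofBijective
    { toFun := fun x => ⟨x.1, x.2⟩
      map_one' := rfl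
      map_mul' := fun _ _ => rfl
      map_zero' := rfl
      map_add' := fun _ _ => rfl
      commutes' := fun _ => rfl }
    ⟨fun _ _ hxy => Subtype.ext congr(($hxy : ℂ)), fun x => ⟨⟨x.1, x.2⟩, rfl⟩⟩

theorem finiteDimensional_extendScalars {M L : IntermediateField F ℂ} (h : M ≤ L)
    [FiniteDimensional F L] : FiniteDimensional M (IntermediateField.extendScalars h) :=
  have := (extendScalarsEquiv h).toLinearEquiv.finiteDimensional
  FiniteDimensional.right F M (IntermediateField.extendScalars h)

theorem finiteDimensional_of_le {M L : IntermediateField F ℂ} (h : M ≤ L)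
    [FiniteDimensional F L] : FiniteDimensional F M :=
  have := (extendScalarsEquiv h).toLinearEquiv.finiteDimensional
  FiniteDimensional.left F M (IntermediateField.extendScalars h)

/-- Transitivity of the trace: the trace from L to M of an element of M multiplies it by the degree.
This is the source of the denominator in the main formula. -/
theorem trace_inclusion {M L : IntermediateField F ℂ} (h : M ≤ L) [FiniteDimensional F L] (y : M) :
    Algebra.trace F L (IntermediateField.inclusion h y) =
      M.relfinrank L • Algebra.trace F M y := by
  have := finiteDimensional_of_le h
  have := finiteDimensional_extendScalars h
  have h1 : extendScalarsEquiv h (IntermediateField.inclusion h y) =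
    algebraMap M (IntermediateField.extendScalars h) y := rfl
  rw [← Algebra.trace_eq_of_algEquiv (extendScalarsEquiv h), h1, ← Algebra.trace_trace (S := M),
    Algebra.trace_algebraMap, map_nsmul, IntermediateField.relfinrank_eq_finrank_of_le h]

theorem relfinrank_ne_zero {M L : IntermediateField F ℂ} (h : M ≤ L) [FiniteDimensional F L] :
    M.relfinrank L ≠ 0 := by
  have := finiteDimensional_extendScalars h
  rw [IntermediateField.relfinrank_eq_finrank_of_le h]
  exact Module.finrank_pos.ne'

theorem exists_comp_inclusion_eq {M L : IntermediateField F ℂ} (h : M ≤ L) [FiniteDimensional F L]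
    (τ : M →ₐ[F] ℂ) : ∃ σ : L →ₐ[F] ℂ, σ.comp (IntermediateField.inclusion h) = τ := by
  let _ := (IntermediateField.inclusion h).toRingHom.toAlgebra
  have : IsScalarTower F M L := IsScalarTower.of_algebraMap_eq' rfl
  have : Algebra.IsAlgebraic M L := Algebra.IsAlgebraic.tower_top (K := F) M
  exact IsAlgClosed.surjective_domRestrict_of_isAlgebraic τ

theorem finiteDimensional_valueField {H : Type*} [Group H] [Finite H] (χ : H →* ℂˣ) :
    FiniteDimensional F (valueField F (linFun χ)) := by
  refine IntermediateField.finiteDimensional_adjoin ?_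
  rintro _ ⟨h, rfl⟩
  refine IsIntegral.of_pow (Nat.card_pos (α := H)) ?_
  have : linFun χ h ^ Nat.card H = 1 := by
    rw [linFun, ← Units.val_pow_eq_pow_val, ← map_pow, pow_card_eq_one', map_one, Units.val_one]
  rw [this]
  exact isIntegral_one

end Fields

/-! ### Sums of conjugates in the group algebra -/

section Conjugates

variable {k : Type*} [Field k] {G : Type*} [Group G]

theorem coeff_sum_single_inv [Fintype G] (f : G → k) (x : G) :
    (∑ g : G, single g⁻¹ (f g) : MonoidAlgebra k G).coeff x = f x⁻¹ := by
  classical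
  rw [coeff_sum, Finsupp.finsetSum_apply, Finset.sum_eq_single x⁻¹]
  · simp
  · intro g _ hg
    rw [coeff_single, Finsupp.single_apply, if_neg]
    rintro rfl
    exact hg (inv_inv g).symm
  · simp

theorem conjBy_eq_conjBy_iff (α : MonoidAlgebra k G) (g g' : G) :
    conjBy α g = conjBy α g' ↔ g * g'⁻¹ ∈ Cen α := by
  change _ ↔ conjBy α (g * g'⁻¹) = α
  rw [conjBy_mul]
  constructor
  · intro h
    rw [h, ← conjBy_mul, mul_inv_cancel, conjBy_one]
  · intro h
    simpa [← conjBy_mul] using congrArg (conjBy · g') h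

/-- The fibres of g ↦ α^g are the right cosets of the centralizer. -/
theorem sum_conjBy [Fintype G] (α : MonoidAlgebra k G) :
    ∑ g : G, conjBy α g =
      (Nat.card (Cen α) : k) • ∑ x ∈ (Set.finite_range (conjBy α)).toFinset, x := by
  classical
  have himg : (Set.finite_range (conjBy α)).toFinset = Finset.univ.image (conjBy α) := by
    ext; simp
  have h1 := Finset.sum_comp (s := (Finset.univ : Finset G)) id (conjBy α)
  simp only [id] at h1
  rw [h1, himg, Finset.smul_sum]
  refine Finset.sum_congr rfl fun b hb => ?_
  obtain ⟨g₀, -, rfl⟩ := Finset.mem_image.1 hb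
  rw [← Nat.cast_smul_eq_nsmul k, ← Fintype.card_subtype, ← Nat.card_eq_fintype_card]
  congr 2
  refine Nat.card_congr ((Equiv.mulRight g₀⁻¹).subtypeEquiv fun g => ?_)
  rw [conjBy_eq_conjBy_iff, Equiv.coe_mulRight]

end Conjugates

/-! ### Shoda pairs and descent to F -/

section ShodaPairs

variable {F : Type*} [Field F] [Algebra F ℂ] {G : Type*} [Group G] {H : Subgroup G}

/-- A linear character as a monoid homomorphism to `ℂ`. -/
def linChar (χ : H →* ℂˣ) : H →* ℂ := (Units.coeHom ℂ).comp χ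

variable (F) in
/-- A linear character as a monoid homomorphism to its field of values. -/
def valueChar (χ : H →* ℂˣ) : H →* valueField F (linFun χ) where
  toFun := valueIn F (linFun χ)
  map_one' := Subtype.ext (by simp [valueIn, linFun])
  map_mul' a b := Subtype.ext (by simp [valueIn, linFun])

/-- The conjugate of a linear character under an embedding of its field of values. -/
def conjChar (χ : H →* ℂˣ) (σ : valueField F (linFun χ) →ₐ[F] ℂ) : H →* ℂ :=
  ((σ : valueField F (linFun χ) →+* ℂ) : valueField F (linFun χ) →* ℂ).comp (valueChar F χ)

theorem conjChar_val (χ : H →* ℂˣ) :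
    conjChar χ (valueField F (linFun χ)).val = linChar χ := rfl

/-- If χ(g⁻¹hg) = χ(h) whenever both are defined, every commutator h⁻¹g⁻¹hg in H lies in ker χ = K,
so g ∈ H. -/
theorem IsShodaPair.isSeparated {K : Subgroup G} (hHK : IsShodaPair H K) {χ : H →* ℂˣ}
    (hχ : χ.ker.map H.subtype = K) : IsSeparated (linChar χ) := by
  intro g hg
  by_contra! hcon
  refine hg (hHK.mem_of_commutators g fun h hh hm => ?_)
  have hx : g⁻¹ * h * g ∈ H := by
    have := H.mul_mem hh hm
    simpa [← mul_assoc] using this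
  have h1 : χ ⟨_, hx⟩ = χ ⟨h, hh⟩ := Units.ext (hcon ⟨h, hh⟩ hx)
  rw [← hχ]
  refine ⟨⟨h, hh⟩⁻¹ * ⟨_, hx⟩, ?_, by simp [mul_assoc]⟩
  simp [MonoidHom.mem_ker, h1]

theorem IsSeparated.conjChar {χ : H →* ℂˣ} (hχ : IsSeparated (linChar χ))
    (σ : valueField F (linFun χ) →ₐ[F] ℂ) : IsSeparated (conjChar χ σ) := by
  refine IsSeparated.map (θ := valueChar F χ) ?_ (σ : valueField F (linFun χ) →+* ℂ)
  intro g hg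
  obtain ⟨h, hh, hne⟩ := hχ g hg
  exact ⟨h, hh, fun e => hne congr(($e : ℂ))⟩

variable [Fintype G] [Fintype H]

omit [Fintype H] in
theorem inducedCharacter_eq (χ : H →* ℂˣ) : inducedCharacter (linFun χ) = indChar (linChar χ) := by
  ext g
  rw [inducedCharacter, finsum_eq_sum_of_fintype]
  rfl

omit [Fintype H] in
theorem coe_indChar_valueChar (χ : H →* ℂˣ) (g : G) :
    ((indChar (valueChar F χ) g : valueField F (linFun χ)) : ℂ) = indChar (linChar χ) g :=
  map_indChar (valueField F (linFun χ)).val.toRingHom (valueChar F χ) g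

omit [Fintype H] in
variable (F) in
theorem valueField_indChar_le (χ : H →* ℂˣ) :
    valueField F (indChar (G := G) (linChar χ)) ≤ valueField F (linFun χ) := by
  refine IntermediateField.adjoin_le_iff.2 ?_
  rintro _ ⟨g, rfl⟩
  rw [← coe_indChar_valueChar (F := F)]
  exact (indChar (valueChar F χ) g).2

omit [Fintype H] in
theorem inclusion_valueIn (χ : H →* ℂˣ) (g : G) :
    IntermediateField.inclusion (valueField_indChar_le F χ) (valueIn F (indChar (linChar χ)) g) =
      indChar (valueChar F χ) g :=
  Subtype.ext (coe_indChar_valueChar χ g).symm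

variable (F) in
/-- The element `|H|⁻¹ ∑_{g ∈ G} tr_{F(ψ)/F}(ψ(g)) g⁻¹`, where `ψ` is the character induced
from `χ`. -/
def fieldIdem (χ : H →* ℂˣ) : MonoidAlgebra F G :=
  (Nat.card H : F)⁻¹ • ∑ g : G, single g⁻¹
    (Algebra.trace F (valueField F (indChar (G := G) (linChar χ)))
      (valueIn F (indChar (linChar χ)) g))

/-- The element `|H|⁻¹ ∑_{g ∈ G} τ(ψ(g)) g⁻¹`, where `ψ` is the character induced from `χ`. -/
def embIdem (χ : H →* ℂˣ) (τ : valueField F (indChar (G := G) (linChar χ)) →ₐ[F] ℂ) :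
    MonoidAlgebra ℂ G :=
  (Nat.card H : ℂ)⁻¹ • ∑ g : G, single g⁻¹ (τ (valueIn F (indChar (linChar χ)) g))

theorem embIdem_comp_inclusion (χ : H →* ℂˣ) (σ : valueField F (linFun χ) →ₐ[F] ℂ) :
    embIdem χ (σ.comp (IntermediateField.inclusion (valueField_indChar_le F χ))) =
      indIdem (G := G) (conjChar χ σ) := by
  ext x
  rw [embIdem, coeff_smul_apply, coeff_sum_single_inv, coeff_indIdem, AlgHom.comp_apply,
    inclusion_valueIn, smul_eq_mul]
  congr 1
  exact map_indChar (σ : valueField F (linFun χ) →+* ℂ) _ _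

/-- The coefficients recover τ on the values of ψ, which generate the field. Distinct embeddings
thus give distinct, hence orthogonal, idempotents. -/
theorem embIdem_injective (χ : H →* ℂˣ) :
    Function.Injective (embIdem (F := F) (G := G) χ) := by
  intro τ τ' h
  refine IntermediateField.adjoin_algHom_ext F ?_
  rintro _ ⟨g, rfl⟩
  have h1 : (embIdem χ τ).coeff g⁻¹ = (embIdem χ τ').coeff g⁻¹ := by rw [h]
  simp only [embIdem, coeff_smul_apply, coeff_sum_single_inv, smul_eq_mul, inv_inv] at h1
  exact mul_left_cancel₀ (inv_ne_zero card_subgroup_ne_zero) h1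

omit [Fintype H] in
theorem finiteDimensional_valueField_indChar (χ : H →* ℂˣ) :
    FiniteDimensional F (valueField F (indChar (G := G) (linChar χ))) :=
  have := finiteDimensional_valueField (F := F) χ
  finiteDimensional_of_le (valueField_indChar_le F χ)

variable [CharZero F]

omit [Fintype H] in
theorem mapRingHom_fieldIdem (χ : H →* ℂˣ)
    [FiniteDimensional F (valueField F (indChar (G := G) (linChar χ)))] :
    mapRingHom G (algebraMap F ℂ) (fieldIdem F χ) =
      ∑ τ : valueField F (indChar (G := G) (linChar χ)) →ₐ[F] ℂ, embIdem χ τ := by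
  ext x
  rw [coeff_mapRingHom, fieldIdem, coeff_smul_apply, coeff_sum_single_inv, smul_eq_mul, map_mul,
    trace_eq_sum_embeddings ℂ, coeff_sum, Finsupp.finsetSum_apply, map_inv₀, map_natCast,
    Finset.mul_sum]
  refine Finset.sum_congr rfl fun τ _ => ?_
  rw [embIdem, coeff_smul_apply, coeff_sum_single_inv, smul_eq_mul]

omit [Fintype G] in
theorem mapRingHom_epsilonChar (χ : H →* ℂˣ) [FiniteDimensional F (valueField F (linFun χ))] :
    mapRingHom G (algebraMap F ℂ) (epsilonChar F χ) =
      ∑ σ : valueField F (linFun χ) →ₐ[F] ℂ, charIdem (conjChar χ σ) := by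
  rw [epsilonChar, finsum_eq_sum_of_fintype, mapRingHom_smul, map_sum, map_inv₀, map_natCast]
  simp only [mapRingHom_single, trace_eq_sum_embeddings ℂ, charIdem]
  rw [← Finset.smul_sum, Finset.sum_comm]
  congr 1
  refine Finset.sum_congr rfl fun h _ => ?_
  exact map_sum (singleAddHom (R := ℂ) (h : G)⁻¹) _ _

omit [Fintype G] in
theorem conjBy_epsilonChar (χ : H →* ℂˣ) [FiniteDimensional F (valueField F (linFun χ))]
    (h : H) : conjBy (epsilonChar (G := G) F χ) h = epsilonChar F χ := by
  apply mapRingHom_injective (algebraMap F ℂ)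
  rw [mapRingHom_conjBy, mapRingHom_epsilonChar, conjBy_sum]
  simp only [conjBy_charIdem]

/-- The coefficients on the left are traces from F(χ) of values of ψ; these lie in F(ψ), so the
trace picks up the relative degree. -/
theorem sum_conjBy_epsilonChar (χ : H →* ℂˣ) [FiniteDimensional F (valueField F (linFun χ))] :
    (Nat.card H : F)⁻¹ • ∑ g : G, conjBy (epsilonChar F χ) g =
      ((valueField F (indChar (G := G) (linChar χ))).relfinrank (valueField F (linFun χ)) : F) •
        fieldIdem F χ := by
  apply mapRingHom_injective (algebraMap F ℂ)
  have h1 : mapRingHom G (algebraMap F ℂ)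
      ((Nat.card H : F)⁻¹ • ∑ g : G, conjBy (epsilonChar F χ) g) =
      ∑ σ : valueField F (linFun χ) →ₐ[F] ℂ, indIdem (G := G) (conjChar χ σ) := by
    simp only [mapRingHom_smul, map_sum, mapRingHom_conjBy, mapRingHom_epsilonChar, conjBy_sum,
      indIdem, map_inv₀, map_natCast]
    rw [← Finset.smul_sum, Finset.sum_comm]
  rw [h1]
  ext x
  rw [coeff_mapRingHom, coeff_smul_apply, fieldIdem, coeff_smul_apply, coeff_sum_single_inv,
    smul_eq_mul, smul_eq_mul, mul_left_comm, ← nsmul_eq_mul,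
    ← trace_inclusion (valueField_indChar_le F χ), inclusion_valueIn, map_mul,
    trace_eq_sum_embeddings ℂ, coeff_sum, Finsupp.finsetSum_apply, Finset.mul_sum, map_inv₀,
    map_natCast]
  refine Finset.sum_congr rfl fun σ _ => ?_
  rw [coeff_indIdem]
  congr 1
  exact (map_indChar (σ : valueField F (linFun χ) →+* ℂ) _ _).symm

theorem relIndex_smul_eC {χ : H →* ℂˣ} {K : Subgroup G} (hχ : χ.ker.map H.subtype = K)
    (hle : H ≤ Cen (epsilonChar (G := G) F χ)) [FiniteDimensional F (valueField F (linFun χ))] :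
    ((H.relIndex (Cen (epsilonChar (G := G) F χ)) : F) /
      ((valueField F (indChar (G := G) (linChar χ))).relfinrank (valueField F (linFun χ)) : F)) •
        eC (orbit F χ hχ) = fieldIdem F χ := by
  have h1 := sum_conjBy_epsilonChar (F := F) (G := G) χ
  have h2 : eC (orbit F χ hχ) =
    ∑ x ∈ (Set.finite_range (conjBy (epsilonChar (G := G) F χ))).toFinset, x := rfl
  have h3 : Nat.card (Cen (epsilonChar (G := G) F χ)) =
      Nat.card H * H.relIndex (Cen (epsilonChar (G := G) F χ)) := by
    rw [← Subgroup.relIndex_bot_left, ← Subgroup.relIndex_bot_left,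
      Subgroup.relIndex_mul_relIndex _ _ _ bot_le hle]
  rw [sum_conjBy, ← h2, smul_smul, h3, Nat.cast_mul,
    inv_mul_cancel_left₀ card_subgroup_ne_zero] at h1
  rw [div_eq_inv_mul, mul_smul, h1, smul_smul, inv_mul_cancel₀, one_smul]
  exact Nat.cast_ne_zero.2 (relfinrank_ne_zero (valueField_indChar_le F χ))

theorem isPrimitiveCentralIdempotent_fieldIdem {χ : H →* ℂˣ} (hχ : IsSeparated (linChar χ)) :
    IsPrimitiveCentralIdempotent (fieldIdem (G := G) F χ) ∧
    mapRingHom G (algebraMap F ℂ) (fieldIdem F χ) * charIdem (linChar χ) =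
      charIdem (linChar χ) := by
  have := finiteDimensional_valueField (F := F) χ
  have := finiteDimensional_valueField_indChar (F := F) (G := G) χ
  have hinj := mapRingHom_injective (G := G) (algebraMap F ℂ)
  have hmap := mapRingHom_fieldIdem (F := F) (G := G) χ
  set E := fieldIdem (G := G) F χ with hE
  -- Extending τ to F(χ) identifies its summand with the central idempotent induced from a conjugate
  -- of χ.
  have hext : ∀ (τ : valueField F (indChar (G := G) (linChar χ)) →ₐ[F] ℂ),
      ∃ σ : valueField F (linFun χ) →ₐ[F] ℂ,
      embIdem (G := G) χ τ = indIdem (conjChar χ σ) := fun τ => by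
    obtain ⟨σ, rfl⟩ := exists_comp_inclusion_eq (valueField_indChar_le F χ) τ
    exact ⟨σ, embIdem_comp_inclusion χ σ⟩
  have hmul : ∀ (τ : valueField F (indChar (G := G) (linChar χ)) →ₐ[F] ℂ),
      mapRingHom G (algebraMap F ℂ) E * embIdem χ τ = embIdem χ τ := by
    intro τ
    rw [hmap, Finset.sum_mul, Finset.sum_eq_single τ]
    · obtain ⟨σ, hσ⟩ := hext τ
      rw [hσ, (hχ.conjChar σ).indIdem_mul_self]
    · intro τ' _ hne
      obtain ⟨σ, hσ⟩ := hext τ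
      obtain ⟨σ', hσ'⟩ := hext τ'
      have hne' := (embIdem_injective χ).ne hne
      rw [hσ, hσ'] at hne' ⊢
      exact (hχ.conjChar σ').indIdem_mul_indIdem (hχ.conjChar σ) hne'
    · simp
  have hfix : mapRingHom G (algebraMap F ℂ) E * charIdem (linChar χ) = charIdem (linChar χ) := by
    -- The given embedding of F(χ) in ℂ corresponds to χ itself.
    have h1 := hmul ((valueField F (linFun χ)).val.comp
      (IntermediateField.inclusion (valueField_indChar_le F χ)))
    rw [embIdem_comp_inclusion, conjChar_val] at h1
    have h2 := hχ.indIdem_mul_charIdem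
    rw [← h2, ← mul_assoc, h1]
  have hidem : E * E = E := by
    apply hinj
    rw [map_mul]
    nth_rewrite 2 [hmap]
    rw [Finset.mul_sum, Finset.sum_congr rfl fun τ _ => hmul τ, ← hmap]
  have hcen : E ∈ Subring.center (MonoidAlgebra F G) := by
    refine mem_center_of_conjBy fun g => hinj ?_
    rw [mapRingHom_conjBy]
    refine conjBy_of_mem_center ?_ g
    rw [hmap]
    refine sum_mem fun τ _ => ?_
    obtain ⟨σ, hσ⟩ := hext τ
    rw [hσ]
    exact indIdem_mem_center _
  -- Since a has coefficients in F, the relation a e_χ = 0 already holds over F(χ); applying σ fixes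
  -- a and moves e_χ to its conjugate.
  have hzero : ∀ a : MonoidAlgebra F G, a ∈ Subring.center (MonoidAlgebra F G) →
      mapRingHom G (algebraMap F ℂ) a * charIdem (linChar χ) = 0 → a * E = 0 := by
    intro a ha h0
    have hL : mapRingHom G (algebraMap F (valueField F (linFun χ))) a *
        charIdem (valueChar F χ) = 0 := by
      apply mapRingHom_injective (algebraMap (valueField F (linFun χ)) ℂ)
      rw [map_mul, map_zero, mapRingHom_charIdem, ← h0]
      congr 1
      ext x
      simp [← IsScalarTower.algebraMap_apply]
    have hσ : ∀ σ : valueField F (linFun χ) →ₐ[F] ℂ,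
        mapRingHom G (algebraMap F ℂ) a * charIdem (conjChar χ σ) = 0 := by
      intro σ
      have := congrArg (mapRingHom G (σ : valueField F (linFun χ) →+* ℂ)) hL
      rw [map_mul, map_zero, mapRingHom_charIdem] at this
      rw [← this]
      congr 1
      ext x
      simp
    apply hinj
    rw [map_mul, map_zero, hmap, Finset.mul_sum]
    refine Finset.sum_eq_zero fun τ _ => ?_
    obtain ⟨σ, hτ⟩ := hext τ
    rw [hτ, mul_indIdem (c := 0) (mapRingHom_mem_center _ ha) (by rw [hσ, zero_smul]), zero_smul]
  refine ⟨⟨hcen, hidem, ?_, ?_⟩, hfix⟩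
  · intro h0
    rw [h0, map_zero, zero_mul] at hfix
    exact charIdem_ne_zero _ hfix.symm
  · intro a b ha hb hia hib hab hsum
    have hia' : a * a = a := hia
    have hib' : b * b = b := hib
    have hba : b * a = 0 := by rw [Subring.mem_center_iff.1 ha, hab]
    obtain ⟨c, hc⟩ := hχ.exists_smul_of_mem_center (mapRingHom_mem_center (algebraMap F ℂ) ha)
    obtain ⟨d, hd⟩ := hχ.exists_smul_of_mem_center (mapRingHom_mem_center (algebraMap F ℂ) hb)
    -- The scalars of a and b on e_χ multiply to zero because ba = 0, so one of the two kills e_χ,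
    -- and hence E.
    have hcd : (d * c) • charIdem (linChar χ) = 0 := by
      rw [mul_comm, ← smul_smul, ← hd, ← mul_smul_comm, ← hc, ← mul_assoc, ← map_mul,
        hba, map_zero, zero_mul]
    rw [smul_eq_zero, mul_eq_zero] at hcd
    rcases hcd.resolve_right (charIdem_ne_zero _) with rfl | rfl
    · right
      have := hzero b hb (by rw [hd, zero_smul])
      rwa [hsum, mul_add, hba, hib', zero_add] at this
    · left
      have := hzero a ha (by rw [hc, zero_smul])
      rwa [hsum, mul_add, hab, hia', add_zero] at this

end ShodaPairs

end Shoda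
end

theorem mainTheorem2 {G : Type*} [Group G] [Finite G]
    {F : Type*} [Field F] [NumberField F] [Algebra F ℂ]
    (H K : Subgroup G) (hHK : Shoda.IsShodaPair H K)
    (χ : H →* ℂˣ) (hχ : χ.ker.map H.subtype = K)
    (C : Shoda.Orbits F H K) (hC : C = Shoda.orbit F χ hχ) :
    Shoda.IsIrreducibleCharacter (Shoda.inducedCharacter (Shoda.linFun χ)) ∧
    H ≤ Shoda.Cen (Shoda.epsilon C) ∧
    Shoda.valueField F (Shoda.inducedCharacter (Shoda.linFun χ)) ≤
      Shoda.valueField F (Shoda.linFun χ) ∧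
    Shoda.IsEF F (Shoda.inducedCharacter (Shoda.linFun χ))
      (((H.relIndex (Shoda.Cen (Shoda.epsilon C)) : F) /
        ((Shoda.valueField F (Shoda.inducedCharacter (Shoda.linFun χ))).relfinrank
          (Shoda.valueField F (Shoda.linFun χ)) : F)) • Shoda.eC C) := by
  have := Fintype.ofFinite G
  have := Fintype.ofFinite H
  have := Shoda.finiteDimensional_valueField (F := F) χ
  have hsep := hHK.isSeparated hχ
  subst hC
  -- On the orbit of χ, `epsilon` reduces definitionally to `epsilonChar` at χ, so this also serves
  -- as the second claim.
  have hle : H ≤ Shoda.Cen (Shoda.epsilonChar (G := G) F χ) := fun h hh =>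
    Shoda.conjBy_epsilonChar χ ⟨h, hh⟩
  obtain ⟨hE, hfix⟩ := Shoda.isPrimitiveCentralIdempotent_fieldIdem (F := F) hsep
  rw [Shoda.inducedCharacter_eq]
  refine ⟨?_, hle, Shoda.valueField_indChar_le F χ, ?_⟩
  · have h1 := Shoda.isIrreducibleCharacter_of_isIrreducible _
      (Shoda.isIrreducible_inducedRep (Shoda.linChar χ) hsep)
    rwa [funext (Shoda.character_inducedRep (Shoda.linChar χ))] at h1
  · have h1 := hsep.isEF hE hfix
    rw [← Shoda.relIndex_smul_eC hχ hle] at h1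
    exact h1
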